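/- For integers $n \ge m \ge 1$, a complex equiangular $(n,m)$-frame (complex equiangular tight frame of $n$ vectors in $\mathbb{C}^m$) is a family of vectors $\varphi_1,\dots,\varphi_n\in\mathbb{C}^m$ such that (i) $\|\varphi_i\|=1$ for all $i$; (ii) there is a constant $c$ with $|\langle\varphi_i,\varphi_j\rangle|=c$ for all $i\neq j$; (iii) there is a constant $A>0$ with $\sum_{i=1}^n|\langle\varphi_i,x\rangle|^2=A\|x\|^2$ for all $x\in\mathbb{C}^m$. (For $n\ge 2$ it then follows that $c=\sqrt{\frac{n-m}{m(n-1)}}$ and $A=n/m$.) **Theorem.** There do not exist complex equiangular $(8,3)$-frames, and there do not exist complex equiangular $(8,5)$-frames. -/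

import Mathlib

/-- A finite family `φ 1, …, φ n` in `ℂ ^ m` is a complex equiangular tight frame, for short an
`(n, m)`-frame: unit vectors, with pairwise inner products of one common modulus, that satisfy
the tight frame identity `∑ i, |⟪φ i, x⟫|² = A ‖x‖²` for some constant `A > 0`. -/
structure IsEquiangularTightFrame {n m : ℕ} (φ : Fin n → EuclideanSpace ℂ (Fin m)) : Prop where
  norm_eq_one : ∀ i, ‖φ i‖ = 1
  equiangular : ∃ c : ℝ, ∀ i j, i ≠ j → ‖inner ℂ (φ i) (φ j)‖ = c
  tight : ∃ A : ℝ, 0 < A ∧ ∀ x : EuclideanSpace ℂ (Fin m),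
    ∑ i, ‖inner ℂ (φ i) x‖ ^ 2 = A * ‖x‖ ^ 2

open scoped ComplexConjugate

/-! The projections onto the 8 lines in `ℂ ^ 3` are linearly independent, so they span a hyperplane
of the 9-dimensional matrix space. Hence the operator `X + (5/6) tr(X) 1 - (21/16) ∑ tr(P i X) P i`,
which kills each of them, has rank at most one. In its tensor, the sum over the frame is symmetric
in two indices. Antisymmetrizing removes that sum and leaves `1 - 5/6 = 1/6` times an explicit
tensor, which no rank-one tensor with traceless factor can produce
(`no_rank_one_with_scalar_antisymmetric_part`). The Naimark complement turns an (8,5)-frame into an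
(8,3)-frame. -/

/-- On `ℂ ^ 3`, no tensor `F c d * K a b` of rank one, with `F` traceless, has a nonzero multiple
of the identity as its antisymmetric part. -/
theorem no_rank_one_with_scalar_antisymmetric_part (F K : Fin 3 → Fin 3 → ℂ)
    (h : ∀ a b c d, F c d * K a b - F a d * K c b =
      (1 / 6) * ((if a = d then 1 else 0) * (if b = c then 1 else 0) -
        (if a = b then 1 else 0) * (if c = d then 1 else 0)))
    (ht : ∀ a b, (∑ c, F c c) * K a b = 0) : False := by
  -- Contract `c = d`: the trace term vanishes and the right side gives `(1 - 3)/6`, so `K` is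
  -- inverse to `3F`.
  have hFK : ∀ a b, ∑ c, F a c * K c b = if a = b then 1 / 3 else 0 := by
    intro a b
    have e : ∑ c, (F c c * K a b - F a c * K c b) =
      ∑ c, ((1 / 6) * ((if a = c then (1 : ℂ) else 0) * (if b = c then 1 else 0) -
        (if a = b then 1 else 0) * (if c = c then 1 else 0))) :=
      Finset.sum_congr rfl fun c _ => h a b c c
    rw [Finset.sum_sub_distrib, ← Finset.sum_mul, ht] at e
    rw [zero_sub, neg_eq_iff_eq_neg] at e
    rw [e]
    fin_cases a <;> fin_cases b <;> simp [Fin.sum_univ_three] <;> norm_num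
  have hKF : ∀ a b, ∑ c, K a c * F c b = if a = b then 1 / 3 else 0 := by
    have e : (3 : ℂ) • (Matrix.of F) * Matrix.of K = 1 := by
      ext a b
      rw [Matrix.smul_mul, Matrix.smul_apply, Matrix.mul_apply]
      simp only [Matrix.of_apply, hFK, Matrix.one_apply, smul_eq_mul]
      split_ifs <;> norm_num
    have e' := mul_eq_one_comm.1 e
    intro a b
    have := congrFun (congrFun e' a) b
    rw [Matrix.mul_smul, Matrix.smul_apply, Matrix.mul_apply] at this
    simp only [Matrix.of_apply, Matrix.one_apply, smul_eq_mul] at this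
    split_ifs at this ⊢ <;> linear_combination this / 3
  -- Multiplying by `F` on the right eliminates `K` and leaves linear equations in `F` that force `F
  -- = 0`.
  have key : ∀ a c d e, F c d * (if a = e then 1 / 3 else 0) - F a d * (if c = e then 1 / 3 else 0)
      = (1 / 6) * ((if a = d then F c e else 0) - (if c = d then F a e else 0)) := by
    intro a c d e
    rw [← hKF a e, ← hKF c e, Finset.mul_sum, Finset.mul_sum, ← Finset.sum_sub_distrib]
    have : ∀ b, F c d * (K a b * F b e) - F a d * (K c b * F b e) = (1 / 6) *
        ((if a = d then 1 else 0) * (if b = c then 1 else 0) -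
          (if a = b then 1 else 0) * (if c = d then 1 else 0)) * F b e := fun b => by
      rw [← h]; ring
    rw [Finset.sum_congr rfl fun b _ => this b]
    simp only [mul_assoc, ← Finset.mul_sum, sub_mul, Finset.sum_sub_distrib]
    simp
  have diag : ∀ a c, a ≠ c → F c c = -(1 / 2) * F a a := by
    intro a c hac
    have := key a c c a
    simp only [hac, hac.symm, if_true, if_false] at this
    linear_combination 3 * this
  have off : ∀ a c, a ≠ c → F c a = 0 := by
    intro a c hac
    have := key a c a a
    simp only [hac.symm, if_true, if_false] at this
    linear_combination 6 * this
  have h00 : F 0 0 = 0 := by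
    have h1 := diag 0 1 (by decide)
    have h2 := diag 1 0 (by decide)
    linear_combination (4 / 3) * h2 - (2 / 3) * h1
  have := hFK 0 0
  simp [Fin.sum_univ_three, h00, off 1 0 (by decide), off 2 0 (by decide)] at this

/-! ### Identities for tight and equiangular frames -/

/-- The frame operator of a tight frame is a multiple of the identity. -/
theorem sum_inner_smul_of_tight {n : ℕ} {E : Type*} [NormedAddCommGroup E]
    [InnerProductSpace ℂ E] (φ : Fin n → E) (A : ℝ)
    (h : ∀ x : E, ∑ i, ‖inner ℂ (φ i) x‖ ^ 2 = A * ‖x‖ ^ 2) (x : E) :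
    ∑ i, inner ℂ (φ i) x • φ i = (A : ℂ) • x := by
  let T : E →ₗ[ℂ] E := ∑ i, (innerₛₗ ℂ (φ i)).smulRight (φ i) - (A : ℂ) • LinearMap.id
  have hT : ∀ y, T y = ∑ i, inner ℂ (φ i) y • φ i - (A : ℂ) • y := fun y => by simp [T]
  -- Over `ℂ`, an operator with zero quadratic form is zero, by polarization.
  have : T = 0 := by
    rw [← inner_map_self_eq_zero]
    intro y
    have hy := congrArg (fun r : ℝ => (r : ℂ)) (h y)
    push_cast at hy
    rw [hT, inner_sub_left, sum_inner, inner_smul_left, inner_self_eq_norm_sq_to_K,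
      Complex.conj_ofReal, sub_eq_zero]
    refine Eq.trans (Finset.sum_congr rfl fun i _ => ?_) hy
    rw [inner_smul_left, RCLike.conj_mul]
    rfl
  rw [← sub_eq_zero, ← hT, this, LinearMap.zero_apply]

namespace IsEquiangularTightFrame

variable {n m : ℕ} {φ : Fin n → EuclideanSpace ℂ (Fin m)}

theorem sum_mul_conj_self (hφ : IsEquiangularTightFrame φ) (i : Fin n) :
    ∑ a, φ i a * conj (φ i a) = 1 := by
  have := inner_self_eq_norm_sq_to_K (𝕜 := ℂ) (φ i)
  rw [hφ.norm_eq_one, PiLp.inner_apply] at this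
  simpa only [RCLike.inner_apply, RCLike.ofReal_one, one_pow] using this

/-- Entrywise form of the tight frame identity, with the value of the frame constant. -/
theorem sum_mul_conj (hφ : IsEquiangularTightFrame φ) (hm : m ≠ 0) (a b : Fin m) :
    ∑ i, φ i a * conj (φ i b) = if a = b then (n / m : ℂ) else 0 := by
  obtain ⟨A, -, hA⟩ := hφ.tight
  have e : ∀ a b, ∑ i, φ i a * conj (φ i b) = if a = b then (A : ℂ) else 0 := by
    intro a b
    have := congrArg (fun v : EuclideanSpace ℂ (Fin m) => v a)
      (sum_inner_smul_of_tight φ A hA (EuclideanSpace.single b 1))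
    simp [EuclideanSpace.inner_single_right] at this
    simpa [mul_comm, Pi.single_apply] using this
  have hn : (n : ℂ) = m * A := by
    have h1 := hφ.sum_mul_conj_self
    have h2 : ∑ a, ∑ i, φ i a * conj (φ i a) = ∑ a : Fin m, (A : ℂ) :=
      Finset.sum_congr rfl fun a _ => by simp [e]
    rw [Finset.sum_comm] at h2
    simpa [h1] using h2
  have hm' : (m : ℂ) ≠ 0 := by exact_mod_cast hm
  rw [e, hn, mul_div_cancel_left₀ _ hm']

/-- The common squared modulus of the inner products satisfies `1 + (n - 1) c ^ 2 = n / m`. -/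
theorem exists_inner_mul_inner (hφ : IsEquiangularTightFrame φ) (hm : m ≠ 0) :
    ∃ q : ℂ, (∀ i j, i ≠ j → inner ℂ (φ i) (φ j) * inner ℂ (φ j) (φ i) = q) ∧
      ∀ _ : Fin n, 1 + (n - 1) * q = (n / m : ℂ) := by
  obtain ⟨c, hc⟩ := hφ.equiangular
  have hq : ∀ i j, i ≠ j → inner ℂ (φ i) (φ j) * inner ℂ (φ j) (φ i) = (c : ℂ) ^ 2 := by
    intro i j hij
    rw [← inner_conj_symm (φ j) (φ i), RCLike.mul_conj, hc i j hij]
    rfl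
  refine ⟨(c : ℂ) ^ 2, hq, fun i => ?_⟩
  have hs : ∑ j, inner ℂ (φ i) (φ j) * inner ℂ (φ j) (φ i) = (n / m : ℂ) := by
    have e : ∀ j, inner ℂ (φ i) (φ j) * inner ℂ (φ j) (φ i) =
        ∑ a, ∑ b, φ j a * conj (φ j b) * (conj (φ i a) * φ i b) := fun j => by
      rw [PiLp.inner_apply, PiLp.inner_apply, Finset.sum_mul_sum]
      refine Finset.sum_congr rfl fun a _ => Finset.sum_congr rfl fun b _ => ?_
      simp only [RCLike.inner_apply]
      ring
    rw [Finset.sum_congr rfl fun j _ => e j, Finset.sum_comm]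
    simp_rw [Finset.sum_comm (s := (Finset.univ : Finset (Fin n))), ← Finset.sum_mul,
      hφ.sum_mul_conj hm]
    simp only [ite_mul, zero_mul, Finset.sum_ite_eq, Finset.mem_univ, if_true]
    rw [← Finset.mul_sum, Finset.sum_congr rfl fun a _ => mul_comm (conj (φ i a)) (φ i a),
      hφ.sum_mul_conj_self, mul_one]
  rw [← hs, ← Finset.add_sum_erase _ _ (Finset.mem_univ i),
    Finset.sum_congr rfl fun j hj => hq i j (Finset.ne_of_mem_erase hj).symm,
    inner_self_eq_norm_sq_to_K, hφ.norm_eq_one]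
  have : 1 ≤ n := i.pos
  simp [Finset.card_erase_of_mem, this]

/-! ### Naimark complement -/

/-- The Naimark complement of an equiangular tight frame. -/
theorem exists_complement {k : ℕ} (hφ : IsEquiangularTightFrame φ) (hm : m ≠ 0) (hk : k ≠ 0)
    (hn : n = m + k) : ∃ ψ : Fin n → EuclideanSpace ℂ (Fin k), IsEquiangularTightFrame ψ := by
  have hm0 : (m : ℝ) ≠ 0 := by exact_mod_cast hm
  have hk0 : (k : ℝ) ≠ 0 := by exact_mod_cast hk
  have hn0 : (n : ℝ) ≠ 0 := by exact_mod_cast (show n ≠ 0 by omega)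
  have hnm : (n : ℝ) = m + k := by exact_mod_cast hn
  obtain ⟨s, hs⟩ : ∃ s : ℝ, s * s = m / n := ⟨√(m / n), Real.mul_self_sqrt (by positivity)⟩
  obtain ⟨r, hr⟩ : ∃ r : ℝ, r * r = n / k := ⟨√(n / k), Real.mul_self_sqrt (by positivity)⟩
  have hs' : (s : ℂ) * s = m / n := by rw [← Complex.ofReal_mul, hs]; push_cast; rfl
  have hr' : (r : ℂ) * r = n / k := by rw [← Complex.ofReal_mul, hr]; push_cast; rfl
  -- The rescaled coordinate rows of the frame are orthonormal in `ℂ ^ n`. The zeros are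
  -- placeholders, replaced when the rows are completed to a basis.
  let u : Fin m ⊕ Fin k → EuclideanSpace ℂ (Fin n) :=
    Sum.elim (fun a => WithLp.toLp 2 fun i => s * conj (φ i a)) 0
  have hu : Orthonormal ℂ ((Set.range Sum.inl).domRestrict u) := by
    rw [orthonormal_iff_ite]
    rintro ⟨_, a, rfl⟩ ⟨_, b, rfl⟩
    have e : inner ℂ (u (Sum.inl a)) (u (Sum.inl b)) =
        (s * s : ℂ) * ∑ i, φ i a * conj (φ i b) := by
      rw [PiLp.inner_apply, Finset.mul_sum]
      refine Finset.sum_congr rfl fun i _ => ?_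
      simp [u]
      ring
    refine e.trans ?_
    rw [hφ.sum_mul_conj hm, hs']
    by_cases hab : a = b
    · subst hab
      have : (m : ℂ) ≠ 0 := by exact_mod_cast hm0
      have : (n : ℂ) ≠ 0 := by exact_mod_cast hn0
      rw [if_pos rfl, if_pos rfl]
      field_simp
    · rw [if_neg hab, mul_zero, if_neg]
      exact fun h => hab (Sum.inl_injective (congrArg Subtype.val h))
  obtain ⟨b, hb⟩ := hu.exists_orthonormalBasis_extension_of_card_eq (by simp [hn])
  have hbu : ∀ a i, b (Sum.inl a) i = s * conj (φ i a) := fun a i => by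
    rw [hb _ ⟨a, rfl⟩]
    rfl
  let ψ : Fin n → EuclideanSpace ℂ (Fin k) :=
    fun i => WithLp.toLp 2 fun l => r * conj (b (Sum.inr l) i)
  have hψ : ∀ i j, inner ℂ (ψ i) (ψ j) =
      (n / k : ℂ) * ((if i = j then 1 else 0) - (m / n : ℂ) * inner ℂ (φ i) (φ j)) := by
    intro i j
    -- Parseval for two standard basis vectors: the Gram matrices of old and new rows add up to the
    -- identity.
    have h1 := b.sum_inner_mul_inner (EuclideanSpace.single i 1) (EuclideanSpace.single j 1)
    simp only [EuclideanSpace.inner_single_left, EuclideanSpace.inner_single_right, map_one,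
      one_mul, Fintype.sum_sum_type, hbu, PiLp.single_apply, map_mul, Complex.conj_conj,
      Complex.conj_ofReal] at h1
    have h2 : (if i = j then (1 : ℂ) else 0) = conj (if j = i then (1 : ℂ) else 0) := by
      simp [apply_ite, eq_comm]
    have h3 : ∑ a, s * conj (φ i a) * (s * φ j a) = (m / n : ℂ) * inner ℂ (φ i) (φ j) := by
      rw [PiLp.inner_apply, ← hs', Finset.mul_sum]
      refine Finset.sum_congr rfl fun a _ => ?_
      simp only [RCLike.inner_apply]
      ring
    rw [h2, ← h1, h3, add_sub_cancel_left, PiLp.inner_apply, ← hr', Finset.mul_sum]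
    refine Finset.sum_congr rfl fun l _ => ?_
    simp [ψ]
    ring
  refine ⟨ψ, fun i => ?_, ?_, n / k, by positivity, fun x => ?_⟩
  · have h1 := hψ i i
    rw [inner_self_eq_norm_sq_to_K, inner_self_eq_norm_sq_to_K, hφ.norm_eq_one, if_pos rfl] at h1
    have h2 : ‖ψ i‖ ^ 2 = n / k * (1 - m / n * 1 ^ 2) := by
      apply Complex.ofReal_injective
      push_cast
      simpa using h1
    have h3 : ‖ψ i‖ ^ 2 = 1 := by
      rw [h2, hnm]
      rw [hnm] at hn0
      field_simp
      ring
    exact (pow_eq_one_iff_of_nonneg (norm_nonneg _) two_ne_zero).1 h3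
  · obtain ⟨c, hc⟩ := hφ.equiangular
    refine ⟨n / k * (m / n * c), fun i j hij => ?_⟩
    rw [hψ, if_neg hij, zero_sub, norm_mul, norm_neg, norm_mul, hc i j hij]
    simp
  · have h1 : ∀ i, inner ℂ (ψ i) x = r * (∑ l, x l • b (Sum.inr l)) i := fun i => by
      simp [ψ, PiLp.inner_apply, Finset.mul_sum]
      refine Finset.sum_congr rfl fun l _ => ?_
      ring
    have h2 : ‖∑ l, x l • b (Sum.inr l)‖ ^ 2 = ‖x‖ ^ 2 := by
      have h3 := (b.orthonormal.comp Sum.inr Sum.inr_injective).inner_sum x x Finset.univ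
      rw [← inner_self_eq_norm_sq (𝕜 := ℂ), ← inner_self_eq_norm_sq (𝕜 := ℂ) x]
      refine congrArg _ (h3.trans ?_)
      rw [PiLp.inner_apply]
      exact Finset.sum_congr rfl fun l _ => mul_comm _ _
    simp only [h1, norm_mul, mul_pow, ← Finset.mul_sum]
    rw [← EuclideanSpace.norm_sq_eq, h2, Complex.norm_real, Real.norm_eq_abs, sq_abs, sq, hr]

/-! ### Nonexistence in dimension 3 -/

/-- There is no frame of `8` equiangular vectors in `ℂ ^ 3`: the projections onto the lines span
a hyperplane in the space of matrices, which forces an impossible tensor identity. -/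
theorem not_eight_three {φ : Fin 8 → EuclideanSpace ℂ (Fin 3)}
    (hφ : IsEquiangularTightFrame φ) : False := by
  obtain ⟨q, hq, hq'⟩ := hφ.exists_inner_mul_inner (by decide)
  replace hq' : q = 5 / 21 := by
    have := hq' 0
    norm_num at this
    linear_combination this / 7
  subst hq'
  have hF := hφ.sum_mul_conj (by decide)
  let P : Fin 8 → Matrix (Fin 3) (Fin 3) ℂ :=
    fun i => Matrix.vecMulVec (φ i) (fun a => conj (φ i a))
  have hP : ∀ i a b, P i a b = φ i a * conj (φ i b) := fun _ _ _ => rfl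
  have htr : ∀ i, (P i).trace = 1 := fun i => hφ.sum_mul_conj_self i
  have hPP : ∀ i j, (P i * P j).trace = (16 / 21) * (if i = j then 1 else 0) + 5 / 21 := by
    intro i j
    have e : (P i * P j).trace = inner ℂ (φ i) (φ j) * inner ℂ (φ j) (φ i) := by
      rw [PiLp.inner_apply, PiLp.inner_apply, Finset.sum_mul_sum, Finset.sum_comm]
      refine Finset.sum_congr rfl fun a _ => ?_
      rw [Matrix.diag_apply, Matrix.mul_apply]
      refine Finset.sum_congr rfl fun b _ => ?_
      simp only [RCLike.inner_apply, hP]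
      ring
    rw [e]
    split_ifs with hij
    · rw [hij, inner_self_eq_norm_sq_to_K, hφ.norm_eq_one]
      norm_num
    · rw [hq i j hij]
      ring
  have hsum : ∑ i, P i = (8 / 3 : ℂ) • 1 := by
    ext a b
    rw [Matrix.sum_apply]
    simp only [hP, hF, Matrix.smul_apply, Matrix.one_apply]
    norm_num
  have hli : LinearIndependent ℂ P := by
    rw [Fintype.linearIndependent_iff]
    intro g hg
    have h1 : ∀ i, (16 / 21) * g i + (5 / 21) * ∑ j, g j = 0 := fun i => by
      have h2 : (P i * ∑ j, g j • P j).trace = 0 := by rw [hg, mul_zero, Matrix.trace_zero]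
      simp only [Finset.mul_sum, Matrix.mul_smul, Matrix.trace_sum, Matrix.trace_smul, hPP,
        smul_eq_mul, mul_add, Finset.sum_add_distrib] at h2
      simp [← Finset.sum_mul] at h2
      linear_combination h2
    have h2 : ∑ j, g j = 0 := by
      have h3 : ∑ i, ((16 / 21) * g i + (5 / 21) * ∑ j, g j) = 0 :=
        Finset.sum_eq_zero fun i _ => h1 i
      rw [Finset.sum_add_distrib, ← Finset.mul_sum, Finset.sum_const, Finset.card_univ,
        Fintype.card_fin, nsmul_eq_mul] at h3
      push_cast at h3
      linear_combination (3 / 8) * h3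
    intro i
    have := h1 i
    rw [h2] at this
    linear_combination (21 / 16) * this
  -- The factor `21/16` cancels the diagonal excess of `hPP`; then `5/6 = (21/16)(5/21)(8/3)`
  -- cancels the remaining multiple of `1`.
  let D : Matrix (Fin 3) (Fin 3) ℂ →ₗ[ℂ] Matrix (Fin 3) (Fin 3) ℂ :=
    LinearMap.id + (5 / 6 : ℂ) • (Matrix.traceLinearMap (Fin 3) ℂ ℂ).smulRight 1 -
      (21 / 16 : ℂ) • ∑ i, ((Matrix.traceLinearMap (Fin 3) ℂ ℂ) ∘ₗ
        LinearMap.mulLeft ℂ (P i)).smulRight (P i)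
  have hD : ∀ X, D X = X + (5 / 6 : ℂ) • X.trace • 1 -
      (21 / 16 : ℂ) • ∑ i, (P i * X).trace • P i := fun X => by simp [D]
  have hDP : ∀ j, D (P j) = 0 := fun j => by
    rw [hD, htr]
    simp only [hPP, add_smul, Finset.sum_add_distrib, ← Finset.smul_sum, hsum, mul_smul, ite_smul,
      one_smul, zero_smul, Finset.sum_ite_eq', Finset.mem_univ, if_true]
    module
  have hD1 : D 1 = 0 := by
    have : (1 : Matrix (Fin 3) (Fin 3) ℂ) = (3 / 8 : ℂ) • ∑ i, P i := by
      rw [hsum]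
      module
    rw [this, map_smul, map_sum, Finset.sum_eq_zero fun j _ => hDP j, smul_zero]
  have hrank : Module.finrank ℂ (LinearMap.range D) ≤ 1 := by
    have h1 := LinearMap.finrank_range_add_finrank_ker D
    have h2 : 8 ≤ Module.finrank ℂ (LinearMap.ker D) := by
      rw [← Fintype.card_fin 8, ← finrank_span_eq_card hli]
      refine Submodule.finrank_mono (Submodule.span_le.2 ?_)
      rintro _ ⟨j, rfl⟩
      exact hDP j
    rw [Module.finrank_matrix] at h1
    simp at h1
    omega
  -- `K` may be zero and `f` is then arbitrary, so tracelessness is only available multiplied by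
  -- `K`.
  obtain ⟨⟨K, _⟩, hK⟩ := (finrank_le_one_iff (K := ℂ)).1 hrank
  have hf : ∀ X, ∃ t : ℂ, D X = t • K := fun X => by
    obtain ⟨t, ht⟩ := hK ⟨D X, X, rfl⟩
    exact ⟨t, (congrArg Subtype.val ht).symm⟩
  choose f hf using hf
  have hent : ∀ a b c d, f (Matrix.single d c 1) * K a b =
      (if a = d then 1 else 0) * (if b = c then 1 else 0) +
      5 / 6 * ((if a = b then 1 else 0) * (if c = d then 1 else 0)) -
      (21 / 16) * ∑ i, φ i a * φ i c * conj (φ i b) * conj (φ i d) := by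
    intro a b c d
    have := congrFun (congrFun (hf (Matrix.single d c 1)) a) b
    rw [Matrix.smul_apply, smul_eq_mul] at this
    rw [← this, hD]
    have htrace : (Matrix.single d c (1 : ℂ)).trace = if c = d then 1 else 0 := by
      split_ifs with hcd
      · rw [hcd, Matrix.trace_single_eq_same]
      · exact Matrix.trace_single_eq_of_ne _ _ _ (Ne.symm hcd)
    have hsum' : (∑ i, (P i * Matrix.single d c 1).trace • P i) a b =
        ∑ i, φ i a * φ i c * conj (φ i b) * conj (φ i d) := by
      rw [Matrix.sum_apply]
      refine Finset.sum_congr rfl fun i _ => ?_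
      rw [Matrix.smul_apply, Matrix.trace_mul_single, hP]
      simp only [hP, smul_eq_mul, MulOpposite.op_one, one_smul]
      ring
    rw [Matrix.sub_apply, Matrix.add_apply, Matrix.smul_apply, Matrix.smul_apply, Matrix.smul_apply, hsum',
      htrace, Matrix.single_apply, Matrix.one_apply, smul_eq_mul, smul_eq_mul,
      smul_eq_mul]
    congr 2
    · rw [ite_and, ite_mul, one_mul, zero_mul]
      simp only [eq_comm]
    · ring
  refine no_rank_one_with_scalar_antisymmetric_part (fun c d => f (Matrix.single d c 1))
    (fun a b => K a b) (fun a b c d => ?_) fun a b => ?_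
  -- Exchanging `a` and `c` fixes the quartic sum, so it cancels.
  · rw [hent, hent, Finset.sum_congr rfl fun i _ => by rw [mul_comm (φ i a) (φ i c)]]
    have : ∀ x y : Fin 3, (if x = y then (1 : ℂ) else 0) = if y = x then 1 else 0 := fun x y => by
      simp only [eq_comm]
    rw [this c b, this c d, this b a]
    ring
  · have h1 : (1 : Matrix (Fin 3) (Fin 3) ℂ) = ∑ c, Matrix.single c c 1 :=
      (Matrix.sum_single_one).symm
    have h2 := congrFun (congrFun hD1 a) b
    rw [h1, map_sum, Matrix.sum_apply] at h2
    simp only [hf, Matrix.smul_apply, smul_eq_mul, ← Finset.sum_mul] at h2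
    exact h2

end IsEquiangularTightFrame

theorem mainTheorem1 :
    (¬ ∃ φ : Fin 8 → EuclideanSpace ℂ (Fin 3), IsEquiangularTightFrame φ) ∧
    (¬ ∃ φ : Fin 8 → EuclideanSpace ℂ (Fin 5), IsEquiangularTightFrame φ) := by
  refine ⟨fun ⟨φ, hφ⟩ => hφ.not_eight_three, fun ⟨φ, hφ⟩ => ?_⟩
  obtain ⟨ψ, hψ⟩ := hφ.exists_complement (k := 3) (by decide) (by decide) rfl
  exact hψ.not_eight_three
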